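/- Let $(W,S)$ be an arbitrary (possibly infinite) Coxeter system with length function $\ell$. For $I\subseteq S$ let $W_I=\langle I\rangle$ and $W^I=\{w\in W:\ell(ws)>\ell(w)\text{ for all }s\in I\}$; when $W_I$ is finite let $w_{\circ,I}$ be its longest element. Write $D_L(w)=\{s\in S:\ell(sw)<\ell(w)\}$, and let $\le$ and $\wedge$ denote the right weak order on $W$ ($u\le v$ if and only if $\ell(u)+\ell(u^{-1}v)=\ell(v)$) and its meet. The Davis complex of $W$ is the set of all cosets $xW_I$ with $x\in W$, $I\subseteq S$ and $W_I$ finite; each of them can be written uniquely as $xW_I$ with $x\in W^I$, and cosets are always written in this way below. The facial weak order on the Davis complex is defined by $$xW_I\le yW_J\iff x\le y\ \text{ and }\ xw_{\circ,I}\le yw_{\circ,J}.$$ Theorem. The facial weak order on the Davis complex is a partial order and a meet-semilattice. Moreover, for any two cosets $xW_I$ and $yW_J$ in the Davis complex (with $x\in W^I$, $y\in W^J$), the weak order meets $z=x\wedge y$ and $xw_{\circ,I}\wedge yw_{\circ,J}$ exist, and, with $K=D_L\big(z^{-1}(xw_{\circ,I}\wedge yw_{\circ,J})\big)$, the subgroup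 $W_K$ is finite, $z\in W^K$, and the meet of $xW_I$ and $yW_J$ in the facial weak order is $$xW_I\wedge yW_J=zW_K .$$ -/

import Mathlib

open scoped Pointwise

namespace CoxeterSystem

universe u v

/-- The right weak order on `W`: `x ≤ y` iff `ℓ(x) + ℓ(x⁻¹ y) = ℓ(y)`, i.e. `x` is a prefix of `y`. -/
def WeakLE {B : Type u} {M : CoxeterMatrix B} {W : Type v} [Group W] (cs : CoxeterSystem M W)
    (x y : W) : Prop :=
  cs.length x + cs.length (x⁻¹ * y) = cs.length y

/-- `z` is the meet (greatest lower bound) of `x` and `y` in the right weak order. -/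
def IsWeakMeet {B : Type u} {M : CoxeterMatrix B} {W : Type v} [Group W] (cs : CoxeterSystem M W)
    (x y z : W) : Prop :=
  cs.WeakLE z x ∧ cs.WeakLE z y ∧ ∀ u : W, cs.WeakLE u x → cs.WeakLE u y → cs.WeakLE u z

/-- The standard parabolic subgroup `W_I`, generated by the simple reflections indexed by `I`. -/
def parabolic {B : Type u} {M : CoxeterMatrix B} {W : Type v} [Group W] (cs : CoxeterSystem M W)
    (I : Set B) : Subgroup W :=
  Subgroup.closure (cs.simple '' I)

/-- `I` is spherical: the standard parabolic subgroup `W_I` is finite. -/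
def IsSpherical {B : Type u} {M : CoxeterMatrix B} {W : Type v} [Group W] (cs : CoxeterSystem M W)
    (I : Set B) : Prop :=
  (cs.parabolic I : Set W).Finite

/-- `W^I`, the set of elements of `W` without right descents in `I`
(the minimal length representatives of the cosets in `W / W_I`). -/
def minReps {B : Type u} {M : CoxeterMatrix B} {W : Type v} [Group W] (cs : CoxeterSystem M W)
    (I : Set B) : Set W :=
  {w | ∀ i ∈ I, cs.length w < cs.length (w * cs.simple i)}

/-- The left descent set `D_L(w)`, as a set of indices of simple reflections. -/
def leftDescents {B : Type u} {M : CoxeterMatrix B} {W : Type v} [Group W]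
    (cs : CoxeterSystem M W) (w : W) : Set B :=
  {i | cs.IsLeftDescent w i}

theorem exists_longest {B : Type u} {M : CoxeterMatrix B} {W : Type v} [Group W]
    (cs : CoxeterSystem M W) {I : Set B} (hI : cs.IsSpherical I) :
    ∃ w ∈ cs.parabolic I, ∀ u ∈ cs.parabolic I, cs.length u ≤ cs.length w :=
  Set.exists_max_image (cs.parabolic I : Set W) cs.length hI ⟨1, (cs.parabolic I).one_mem⟩

/-- The longest element `w_{∘,I}` of the finite standard parabolic subgroup `W_I`. -/
noncomputable def longest {B : Type u} {M : CoxeterMatrix B} {W : Type v} [Group W]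
    (cs : CoxeterSystem M W) {I : Set B} (hI : cs.IsSpherical I) : W :=
  (cs.exists_longest hI).choose

theorem longest_spec {B : Type u} {M : CoxeterMatrix B} {W : Type v} [Group W]
    (cs : CoxeterSystem M W) {I : Set B} (hI : cs.IsSpherical I) :
    cs.longest hI ∈ cs.parabolic I ∧
      ∀ u ∈ cs.parabolic I, cs.length u ≤ cs.length (cs.longest hI) :=
  (cs.exists_longest hI).choose_spec

/-- The Davis complex: its elements are the cosets `x W_I` (subsets of `W`) with `W_I` finite. -/
@[ext] structure DavisComplex {B : Type u} {M : CoxeterMatrix B} {W : Type v} [Group W]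
    (cs : CoxeterSystem M W) : Type v where
  carrier : Set W
  isCoset : ∃ (x : W) (I : Set B), cs.IsSpherical I ∧ carrier = x • (cs.parabolic I : Set W)

/-- The coset `x W_I`, with `W_I` finite, as an element of the Davis complex. -/
def coset {B : Type u} {M : CoxeterMatrix B} {W : Type v} [Group W] (cs : CoxeterSystem M W)
    (x : W) {I : Set B} (hI : cs.IsSpherical I) : cs.DavisComplex :=
  ⟨x • (cs.parabolic I : Set W), x, I, hI, rfl⟩

/-- The facial weak order: writing `C = x W_I` and `D = y W_J` with minimal length representatives
`x ∈ W^I` and `y ∈ W^J`, one has `C ≤ D` iff `x ≤ y` and `x w_{∘,I} ≤ y w_{∘,J}` in right weak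
order. (Such an expression of a coset exists and is unique.) -/
def FacialLE {B : Type u} {M : CoxeterMatrix B} {W : Type v} [Group W] (cs : CoxeterSystem M W)
    (C D : cs.DavisComplex) : Prop :=
  ∃ (x y : W) (I J : Set B) (hI : cs.IsSpherical I) (hJ : cs.IsSpherical J),
    x ∈ cs.minReps I ∧ y ∈ cs.minReps J ∧ C = cs.coset x hI ∧ D = cs.coset y hJ ∧
    cs.WeakLE x y ∧ cs.WeakLE (x * cs.longest hI) (y * cs.longest hJ)

end CoxeterSystem

namespace CoxeterSystem

variable {B : Type*} {M : CoxeterMatrix B} {W : Type*} [Group W]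

section

open List

variable (cs : CoxeterSystem M W)

/-! ### The inversion cocycle -/

/-! Write N(w) for the finite set of left inversions of w. A sign cocycle gives N(xy) = N(x) Δ
xN(y)x⁻¹ (`mem_inversions_mul`); since |N(w)| = ℓ(w), right weak order is inclusion of inversion
sets (`weakLE_iff`). Weak meets exist in any Coxeter group (`exists_isWeakMeet`).

Given faces xW_I and yW_J, let z and v be the meets of bottoms and of tops; then z ≤ v. With K =
D_L(z⁻¹v), every element of W_K is a prefix of z⁻¹v, so W_K is finite and zw_K ≤ v: the face zW_K is
a lower bound.

For maximality, let aW_L lie below both faces. Then a ≤ z, and aw_L ≤ zw_K follows once each t =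
as_ia⁻¹ with i ∈ L is an inversion of zw_K. By a length count (`exists_inversions_subset_insert`)
adjoining t to N(x) or N(y) gives again an inversion set, and comparing the meet of the enlarged
elements with z (`mem_inversions_or_eq_conj_simple`) shows that t lies in N(z) or equals zs_jz⁻¹. In
the latter case, if t is not in N(z), then t ∈ N(v) forces j ∈ K. -/

theorem end_mul_apply {α : Type*} (f g : Function.End α) (a : α) : (f * g) a = f (g a) := rfl

open Classical in
/-- The action of a simple reflection on `W × ZMod 2` by conjugation on the first factor, flipping
the sign exactly at the simple reflection itself. -/
noncomputable def signedConj (i : B) : Function.End (W × ZMod 2) := fun p ↦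
  (cs.simple i * p.1 * cs.simple i, p.2 + if p.1 = cs.simple i then 1 else 0)

open Classical in
theorem prod_map_signedConj (ω : List B) (p : W × ZMod 2) :
    (ω.map cs.signedConj).prod p =
      (cs.wordProd ω * p.1 * (cs.wordProd ω)⁻¹, p.2 + (cs.rightInvSeq ω).count p.1) := by
  induction ω with
  | nil => simp; rfl
  | cons i ω ih =>
    rw [List.map_cons, List.prod_cons, end_mul_apply, ih]
    simp only [signedConj, rightInvSeq, wordProd_cons, List.count_cons, mul_inv_rev, inv_simple,
      mul_assoc, Prod.mk.injEq, true_and, add_assoc]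
    push_cast
    congr 2
    have : cs.wordProd ω * (p.1 * (cs.wordProd ω)⁻¹) = cs.simple i ↔
        (cs.wordProd ω)⁻¹ * (cs.simple i * cs.wordProd ω) = p.1 := by
      rw [← mul_assoc, mul_inv_eq_iff_eq_mul, inv_mul_eq_iff_eq_mul, eq_comm]
    simp [this]

theorem pow_mul_signedConj (i j : B) (m : ℕ) :
    (cs.signedConj i * cs.signedConj j) ^ m =
      ((alternatingWord j i (2 * m)).reverse.map cs.signedConj).prod := by
  induction m with
  | zero => simp [alternatingWord]
  | succ m ih =>
    rw [pow_succ', ih, show 2 * (m + 1) = 2 * m + 1 + 1 by ring, alternatingWord_succ,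
      alternatingWord_succ]
    simp [mul_assoc]

/-- Shifting the position by `M i j` multiplies the reflection by a power of the braid relator. Thus
every reflection occurs an even number of times, so the signs in the braid relation cancel. -/
theorem leftInvSeq_alternatingWord_two_mul (i j : B) :
    cs.leftInvSeq (alternatingWord i j (2 * M i j)) =
      (cs.leftInvSeq (alternatingWord i j (2 * M i j))).take (M i j) ++
        (cs.leftInvSeq (alternatingWord i j (2 * M i j))).take (M i j) := by
  conv_lhs => rw [← List.take_append_drop (M i j) (cs.leftInvSeq _)]
  congr 1
  apply List.ext_getElem
  · simp; omega
  · intro k h₁ h₂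
    simp only [List.length_drop, length_leftInvSeq, length_alternatingWord] at h₁
    rw [List.getElem_drop, List.getElem_take, cs.getElem_leftInvSeq_alternatingWord _ _ _ _ (by omega),
      cs.getElem_leftInvSeq_alternatingWord _ _ _ _ (by omega), prod_alternatingWord_eq_mul_pow,
      prod_alternatingWord_eq_mul_pow, show (2 * (M i j + k) + 1) / 2 = M i j + k by omega,
      show (2 * k + 1) / 2 = k by omega, pow_add, simple_mul_simple_pow']
    simp

theorem isLiftable_signedConj : M.IsLiftable cs.signedConj := by
  classical
  intro i j
  rw [pow_mul_signedConj]
  funext p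
  rw [prod_map_signedConj, rightInvSeq_reverse, List.count_reverse, wordProd_reverse,
    prod_alternatingWord_eq_mul_pow, M.symmetric i j, leftInvSeq_alternatingWord_two_mul]
  simp only [even_two, Even.mul_right, if_true, List.count_append]
  rw [Nat.mul_div_cancel_left _ two_pos, simple_mul_simple_pow]
  push_cast
  simp [CharTwo.add_self_eq_zero]
  rfl

/-- The parity of the number of occurrences of `t` in the left inversion sequence of any word
for `w`. -/
noncomputable def invParity (w t : W) : ZMod 2 :=
  (cs.lift ⟨cs.signedConj, cs.isLiftable_signedConj⟩ w⁻¹ (t, 0)).2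

theorem lift_signedConj_wordProd (ω : List B) :
    cs.lift ⟨cs.signedConj, cs.isLiftable_signedConj⟩ (cs.wordProd ω) =
      (ω.map cs.signedConj).prod := by
  rw [wordProd, map_list_prod, List.map_map]
  congr 2
  funext i
  simp

open Classical in
theorem lift_signedConj_apply (w : W) (p : W × ZMod 2) :
    cs.lift ⟨cs.signedConj, cs.isLiftable_signedConj⟩ w p =
      (w * p.1 * w⁻¹, p.2 + cs.invParity w⁻¹ p.1) := by
  obtain ⟨ω, rfl⟩ := cs.wordProd_surjective w
  simp [invParity, lift_signedConj_wordProd, prod_map_signedConj]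

open Classical in
theorem invParity_wordProd (ω : List B) (t : W) :
    cs.invParity (cs.wordProd ω) t = (cs.leftInvSeq ω).count t := by
  rw [invParity, ← wordProd_reverse, lift_signedConj_wordProd, prod_map_signedConj,
    rightInvSeq_reverse, List.count_reverse, zero_add]

theorem invParity_mul (x y t : W) :
    cs.invParity (x * y) t = cs.invParity x t + cs.invParity y (x⁻¹ * t * x) := by
  rw [invParity, mul_inv_rev, map_mul, end_mul_apply,
    lift_signedConj_apply, lift_signedConj_apply]
  simp

@[simp]
theorem invParity_one (t : W) : cs.invParity 1 t = 0 := by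
  classical
  simpa using cs.invParity_wordProd [] t

open Classical in
theorem invParity_simple (i : B) (t : W) :
    cs.invParity (cs.simple i) t = if t = cs.simple i then 1 else 0 := by
  have := cs.invParity_wordProd [i] t
  simp only [wordProd_singleton, leftInvSeq_singleton, List.count_singleton] at this
  rw [this]
  by_cases h : t = cs.simple i
  · simp [h]
  · simp [h, Ne.symm h]

theorem invParity_inv (x t : W) : cs.invParity x⁻¹ t = cs.invParity x (x * t * x⁻¹) := by
  have := cs.invParity_mul x⁻¹ x t
  simp only [inv_mul_cancel, invParity_one, inv_inv] at this
  exact CharTwo.add_eq_zero.mp this.symm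

/-- For t = wsw⁻¹ the contributions of w and w⁻¹ coincide and cancel mod 2, leaving that of s. -/
theorem IsReflection.invParity_self {cs : CoxeterSystem M W} {t : W} (ht : cs.IsReflection t) :
    cs.invParity t t = 1 := by
  obtain ⟨w, i, rfl⟩ := ht
  rw [mul_assoc, invParity_mul, invParity_mul, invParity_inv, invParity_simple]
  simp only [inv_simple]
  group
  simp [add_comm]
  grind

/-! ### Left inversion sets -/

theorem zmod_two_not_eq_one_iff {a : ZMod 2} : ¬ a = 1 ↔ a = 0 := by
  revert a; decide

/-- The set of left inversions of `w`. -/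
def inversions (w : W) : Set W := {t | cs.IsLeftInversion w t}

theorem invParity_wordProd_eq_one_iff {ω : List B} (hω : cs.IsReduced ω) {t : W} :
    cs.invParity (cs.wordProd ω) t = 1 ↔ t ∈ cs.leftInvSeq ω := by
  classical
  rw [invParity_wordProd]
  by_cases h : t ∈ cs.leftInvSeq ω
  · simp [h, List.count_eq_one_of_mem hω.nodup_leftInvSeq h]
  · simp [h, List.count_eq_zero_of_not_mem h]

theorem isLeftInversion_of_invParity {w t : W} (h : cs.invParity w t = 1) :
    cs.IsLeftInversion w t := by
  obtain ⟨ω, hω, rfl⟩ := cs.exists_isReduced w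
  exact cs.isLeftInversion_of_mem_leftInvSeq hω ((cs.invParity_wordProd_eq_one_iff hω).1 h)

theorem mem_inversions_iff {w t : W} : t ∈ cs.inversions w ↔ cs.invParity w t = 1 := by
  refine ⟨fun ⟨ht, h⟩ ↦ ?_, cs.isLeftInversion_of_invParity⟩
  by_contra h'
  rw [zmod_two_not_eq_one_iff] at h'
  -- If the parity of w at t were 0, that of tw would be 1, making t an inversion of tw as well as
  -- of w.
  have := cs.invParity_mul t w t
  rw [ht.invParity_self, inv_mul_cancel, one_mul, h', add_zero] at this
  have := (cs.isLeftInversion_of_invParity this).2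
  rw [← mul_assoc, ht.mul_self, one_mul] at this
  omega

theorem inversions_wordProd {ω : List B} (hω : cs.IsReduced ω) :
    cs.inversions (cs.wordProd ω) = {t | t ∈ cs.leftInvSeq ω} := by
  ext t
  rw [mem_inversions_iff, invParity_wordProd_eq_one_iff _ hω, Set.mem_ofPred_eq]

theorem finite_inversions (w : W) : (cs.inversions w).Finite := by
  obtain ⟨ω, hω, rfl⟩ := cs.exists_isReduced w
  rw [inversions_wordProd _ hω]
  exact List.finite_toSet _

theorem ncard_inversions (w : W) : (cs.inversions w).ncard = cs.length w := by
  classical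
  obtain ⟨ω, hω, rfl⟩ := cs.exists_isReduced w
  rw [inversions_wordProd _ hω, hω.eq, ← cs.length_leftInvSeq,
    ← List.toFinset_card_of_nodup hω.nodup_leftInvSeq, ← Set.ncard_coe_finset]
  congr 1
  ext; simp

theorem mem_inversions_mul {x y t : W} : t ∈ cs.inversions (x * y) ↔
    Xor (t ∈ cs.inversions x) (x⁻¹ * t * x ∈ cs.inversions y) := by
  simp only [mem_inversions_iff, invParity_mul]
  generalize cs.invParity x t = a
  generalize cs.invParity y _ = b
  revert a b
  unfold Xor
  decide

theorem simple_mem_inversions {w : W} {i : B} :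
    cs.simple i ∈ cs.inversions w ↔ cs.IsLeftDescent w i :=
  cs.isLeftInversion_simple_iff_isLeftDescent w i

@[simp]
theorem inversions_one : cs.inversions 1 = ∅ := by
  ext; simp [mem_inversions_iff]

@[simp]
theorem inversions_simple (i : B) : cs.inversions (cs.simple i) = {cs.simple i} := by
  classical
  ext; simp [mem_inversions_iff, invParity_simple]

theorem mem_inversions_inv {w t : W} :
    t ∈ cs.inversions w⁻¹ ↔ w * t * w⁻¹ ∈ cs.inversions w := by
  rw [mem_inversions_iff, mem_inversions_iff, invParity_inv]

end

variable {cs : CoxeterSystem M W}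

/-! ### The weak order -/

theorem weakLE_mul_iff {x y : W} :
    cs.WeakLE x (x * y) ↔ cs.length (x * y) = cs.length x + cs.length y := by
  rw [WeakLE, inv_mul_cancel_left, eq_comm]

/-- A common element cancels in the symmetric difference and costs each side one element, so |N(xy)|
would fall short of ℓ(x) + ℓ(y). -/
theorem disjoint_inversions_of_length_mul {x y t : W}
    (h : cs.length (x * y) = cs.length x + cs.length y) (hx : t ∈ cs.inversions x) :
    x⁻¹ * t * x ∉ cs.inversions y := by
  intro hy
  have h₁ : (cs.inversions (x * y)) ⊆
      (cs.inversions x \ {t}) ∪ (fun r ↦ x * r * x⁻¹) '' (cs.inversions y \ {x⁻¹ * t * x}) := by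
    intro r hr
    rcases cs.mem_inversions_mul.1 hr with ⟨h₁, h₂⟩ | ⟨h₁, h₂⟩
    · exact Or.inl ⟨h₁, by rintro rfl; exact h₂ hy⟩
    · refine Or.inr ⟨_, ⟨h₁, fun h ↦ ?_⟩, by group⟩
      simp only [Set.mem_singleton_iff, mul_left_inj, mul_right_inj] at h
      exact h₂ (h ▸ hx)
  have f₁ := (cs.finite_inversions x).subset (Set.sdiff_subset (t := {t}))
  have f₂ := (cs.finite_inversions y).subset (Set.sdiff_subset (t := {x⁻¹ * t * x}))
  have h₂ := Set.ncard_le_ncard h₁ (f₁.union (f₂.image _))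
  have h₃ := Set.ncard_union_le (cs.inversions x \ {t})
    ((fun r ↦ x * r * x⁻¹) '' (cs.inversions y \ {x⁻¹ * t * x}))
  have h₄ := Set.ncard_image_le (f := fun r ↦ x * r * x⁻¹) f₂
  have h₅ := Set.ncard_sdiff_singleton_lt_of_mem hx (cs.finite_inversions x)
  have h₆ := Set.ncard_sdiff_singleton_lt_of_mem hy (cs.finite_inversions y)
  simp only [ncard_inversions] at *
  omega

theorem length_mul_of_disjoint_inversions {x y : W}
    (h : ∀ t ∈ cs.inversions x, x⁻¹ * t * x ∉ cs.inversions y) :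
    cs.length (x * y) = cs.length x + cs.length y := by
  have inj : Function.Injective fun r ↦ x * r * x⁻¹ := fun a b hab ↦ by simpa using hab
  have h₁ : cs.inversions (x * y) = cs.inversions x ∪ (fun r ↦ x * r * x⁻¹) '' cs.inversions y := by
    ext r
    have : r ∈ (fun r ↦ x * r * x⁻¹) '' cs.inversions y ↔ x⁻¹ * r * x ∈ cs.inversions y := by
      constructor
      · rintro ⟨a, ha, rfl⟩
        convert! ha using 1
        group
      · exact fun hr ↦ ⟨_, hr, by group⟩
    rw [mem_inversions_mul, Set.mem_union, this]
    have := h r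
    unfold Xor
    tauto
  have h₂ : Disjoint (cs.inversions x) ((fun r ↦ x * r * x⁻¹) '' cs.inversions y) := by
    rw [Set.disjoint_left]
    rintro t ht ⟨a, ha, rfl⟩
    apply h _ ht
    convert! ha using 1
    group
  rw [← ncard_inversions, h₁, Set.ncard_union_eq h₂ (cs.finite_inversions x)
    ((cs.finite_inversions y).image _), Set.ncard_image_of_injective _ inj, ncard_inversions,
    ncard_inversions]

theorem weakLE_iff {x y : W} : cs.WeakLE x y ↔ cs.inversions x ⊆ cs.inversions y := by
  obtain ⟨u, rfl⟩ : ∃ u, y = x * u := ⟨x⁻¹ * y, by group⟩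
  rw [weakLE_mul_iff]
  constructor
  · exact fun h t ht ↦ cs.mem_inversions_mul.2 (Or.inl ⟨ht, disjoint_inversions_of_length_mul h ht⟩)
  · refine fun h ↦ length_mul_of_disjoint_inversions fun t ht ht' ↦ ?_
    rcases cs.mem_inversions_mul.1 (h ht) with ⟨_, h₂⟩ | ⟨_, h₂⟩
    · exact h₂ ht'
    · exact h₂ ht

theorem WeakLE.refl (x : W) : cs.WeakLE x x := by simp [WeakLE]

theorem WeakLE.trans {x y z : W} (h₁ : cs.WeakLE x y) (h₂ : cs.WeakLE y z) : cs.WeakLE x z := by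
  rw [weakLE_iff] at *
  exact h₁.trans h₂

theorem WeakLE.length_le {x y : W} (h : cs.WeakLE x y) : cs.length x ≤ cs.length y := by
  unfold WeakLE at h; omega

theorem WeakLE.eq_of_length_le {x y : W} (h : cs.WeakLE x y) (h' : cs.length y ≤ cs.length x) :
    x = y := by
  unfold WeakLE at h
  have : cs.length (x⁻¹ * y) = 0 := by omega
  rwa [length_eq_zero_iff, inv_mul_eq_one] at this

theorem WeakLE.antisymm {x y : W} (h₁ : cs.WeakLE x y) (h₂ : cs.WeakLE y x) : x = y :=
  h₁.eq_of_length_le h₂.length_le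

theorem one_weakLE (x : W) : cs.WeakLE 1 x := by simp [WeakLE]

theorem finite_weakLE (w : W) : {u | cs.WeakLE u w}.Finite := by
  refine Set.Finite.of_finite_image (f := cs.inversions)
    ((cs.finite_inversions w).finite_subsets.subset ?_) ?_
  · rintro _ ⟨u, hu, rfl⟩
    exact weakLE_iff.1 hu
  · intro u _ v _ h
    exact (weakLE_iff.2 h.subset).antisymm (weakLE_iff.2 h.symm.subset)

/-- Left translation by a common prefix preserves the weak order. -/
theorem WeakLE.mul_left_iff {a u v : W} (hu : cs.WeakLE a (a * u)) (hv : cs.WeakLE a (a * v)) :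
    cs.WeakLE (a * u) (a * v) ↔ cs.WeakLE u v := by
  rw [weakLE_mul_iff] at hu hv
  rw [WeakLE, WeakLE, hu, hv, mul_inv_rev, mul_assoc, inv_mul_cancel_left]
  omega

theorem WeakLE.mul_left {a u v : W} (h : cs.WeakLE u v) (hv : cs.WeakLE a (a * v)) :
    cs.WeakLE a (a * u) ∧ cs.WeakLE (a * u) (a * v) := by
  have hu : cs.WeakLE a (a * u) := by
    rw [weakLE_mul_iff] at *
    have h₁ := cs.length_mul_le a u
    have h₂ := cs.length_mul_le (a * u) (u⁻¹ * v)
    rw [mul_assoc, mul_inv_cancel_left] at h₂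
    unfold WeakLE at h
    omega
  exact ⟨hu, (hu.mul_left_iff hv).2 h⟩

theorem simple_weakLE_iff {i : B} {w : W} :
    cs.WeakLE (cs.simple i) w ↔ cs.IsLeftDescent w i := by
  simp [weakLE_iff, simple_mem_inversions]

theorem weakLE_mul_simple_iff {w : W} {i : B} :
    cs.WeakLE w (w * cs.simple i) ↔ cs.length w < cs.length (w * cs.simple i) := by
  rw [weakLE_mul_iff, length_simple]
  have := cs.length_mul_simple w i
  omega

theorem inversions_mul_simple {w : W} {i : B} (h : cs.WeakLE w (w * cs.simple i)) :
    cs.inversions (w * cs.simple i) = insert (w * cs.simple i * w⁻¹) (cs.inversions w) := by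
  ext t
  have h₀ : t ∈ cs.inversions w → _ := fun ht ↦ weakLE_iff.1 h ht
  rw [mem_inversions_mul, inversions_simple, Set.mem_singleton_iff,
    mul_assoc, inv_mul_eq_iff_eq_mul, ← eq_mul_inv_iff_mul_eq] at *
  rw [Set.mem_insert_iff]
  unfold Xor at *
  tauto

theorem exists_mul_simple_weakLE {x y : W} (h : cs.WeakLE x y) (hne : x ≠ y) :
    ∃ i, cs.IsLeftDescent (x⁻¹ * y) i ∧ cs.WeakLE x (x * cs.simple i) ∧
      cs.WeakLE (x * cs.simple i) y := by
  obtain ⟨i, hi⟩ := cs.exists_leftDescent_of_ne_one (w := x⁻¹ * y) (by rwa [Ne, inv_mul_eq_one])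
  have := (simple_weakLE_iff.2 hi).mul_left (a := x) (by simpa using h)
  exact ⟨i, hi, this.1, by simpa using this.2⟩

/-- Lifting: a left descent of `w` may be prepended to a prefix of `w` that does not have it. -/
theorem WeakLE.simple_mul {a w : W} {i : B} (h : cs.WeakLE a w) (hw : cs.IsLeftDescent w i)
    (ha : ¬ cs.IsLeftDescent a i) : cs.WeakLE (cs.simple i * a) w := by
  obtain ⟨v, rfl⟩ : ∃ v, w = a * v := ⟨a⁻¹ * w, by group⟩
  rw [weakLE_mul_iff] at h
  -- The simple reflection is an inversion of av but not of a, so its conjugate is an inversion of v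
  -- and shortens v.
  have ht : a⁻¹ * cs.simple i * a ∈ cs.inversions v := by
    rcases cs.mem_inversions_mul.1 (simple_mem_inversions _ |>.2 hw) with ⟨h₁, _⟩ | ⟨h₁, _⟩
    · exact absurd (simple_mem_inversions _ |>.1 h₁) ha
    · exact h₁
  have h₁ := ht.2
  have h₂ := cs.not_isLeftDescent_iff.1 ha
  have e : (cs.simple i * a)⁻¹ * (a * v) = a⁻¹ * cs.simple i * a * v := by simp [mul_assoc]
  have h₃ := cs.length_mul_le (cs.simple i * a) ((cs.simple i * a)⁻¹ * (a * v))
  rw [mul_inv_cancel_left] at h₃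
  rw [WeakLE]
  rw [e] at *
  omega

/-! ### Parabolic subgroups -/

theorem simple_mem_parabolic {I : Set B} {i : B} (hi : i ∈ I) : cs.simple i ∈ cs.parabolic I :=
  Subgroup.subset_closure ⟨i, hi, rfl⟩

theorem inversions_subset_parabolic {I : Set B} {u : W} (hu : u ∈ cs.parabolic I) :
    cs.inversions u ⊆ cs.parabolic I := by
  have key : ∀ v w : W, v ∈ cs.parabolic I → cs.inversions v ⊆ cs.parabolic I →
      cs.inversions w ⊆ cs.parabolic I → cs.inversions (v * w) ⊆ cs.parabolic I := by
    intro v w hv h₁ h₂ t ht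
    rcases cs.mem_inversions_mul.1 ht with ⟨h, _⟩ | ⟨h, _⟩
    · exact h₁ h
    · have := mul_mem (mul_mem hv (h₂ h)) (inv_mem hv)
      convert! this using 1
      group
  induction hu using Subgroup.closure_induction with
  | mem x hx =>
    obtain ⟨i, hi, rfl⟩ := hx
    simpa using simple_mem_parabolic hi
  | one => simp
  | mul x y hx hy h₁ h₂ => exact key x y hx h₁ h₂
  | inv x hx h =>
    intro t ht
    have hx : x ∈ cs.parabolic I := hx
    have := mul_mem (mul_mem (inv_mem hx) (h (cs.mem_inversions_inv.1 ht))) hx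
    convert! this using 1
    group

/-- Prepending a letter of I to a reduced word either keeps it reduced or, by the exchange property,
deletes one of its letters; no letter outside I appears. -/
theorem exists_isReduced_of_mem_parabolic {I : Set B} {u : W} (hu : u ∈ cs.parabolic I) :
    ∃ ω : List B, cs.IsReduced ω ∧ (∀ i ∈ ω, i ∈ I) ∧ u = cs.wordProd ω := by
  have key : ∀ i ∈ I, ∀ u : W,
      (∃ ω : List B, cs.IsReduced ω ∧ (∀ i ∈ ω, i ∈ I) ∧ u = cs.wordProd ω) →
      ∃ ω : List B, cs.IsReduced ω ∧ (∀ i ∈ ω, i ∈ I) ∧ cs.simple i * u = cs.wordProd ω := by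
    rintro i hi _ ⟨ω, hω, hωI, rfl⟩
    by_cases hd : cs.IsLeftDescent (cs.wordProd ω) i
    · have hmem : cs.simple i ∈ cs.leftInvSeq ω := by
        simpa [inversions_wordProd _ hω] using (simple_mem_inversions _).2 hd
      obtain ⟨j, hj, h⟩ := List.mem_iff_getElem.1 hmem
      have he := cs.getD_leftInvSeq_mul_wordProd ω j
      rw [List.getD_eq_getElem _ _ hj, h] at he
      refine ⟨ω.eraseIdx j, ?_, fun k hk ↦ hωI k (List.mem_of_mem_eraseIdx hk), he⟩
      rw [length_leftInvSeq] at hj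
      have := List.length_eraseIdx_add_one hj
      have := cs.isLeftDescent_iff.1 hd
      rw [hω.eq, he] at this
      rw [IsReduced]
      omega
    · refine ⟨i :: ω, ?_, by simpa using ⟨hi, hωI⟩, (cs.wordProd_cons i ω).symm⟩
      rw [IsReduced, wordProd_cons, cs.not_isLeftDescent_iff.1 hd, hω.eq, List.length_cons]
  induction hu using Subgroup.closure_induction_left with
  | one => exact ⟨[], by simp [IsReduced], by simp, by simp⟩
  | mul_left x hx y hy ih =>
    obtain ⟨i, hi, rfl⟩ := hx
    exact key i hi y ih
  | inv_mul_cancel x hx y hy ih =>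
    obtain ⟨i, hi, rfl⟩ := hx
    rw [inv_simple]
    exact key i hi y ih

theorem exists_rightDescent_of_mem_parabolic {I : Set B} {u : W} (hu : u ∈ cs.parabolic I)
    (hne : u ≠ 1) : ∃ i ∈ I, cs.IsRightDescent u i := by
  obtain ⟨ω, hω, hI, h⟩ := exists_isReduced_of_mem_parabolic (inv_mem hu)
  rcases ω with _ | ⟨i, ω⟩
  · simp at h
    exact absurd h hne
  · refine ⟨i, hI i (by simp), ?_⟩
    rw [← isLeftDescent_inv_iff, h, IsLeftDescent, hω.eq, wordProd_cons,
      simple_mul_simple_cancel_left]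
    exact Nat.lt_succ_of_le (cs.length_wordProd_le ω)

/-- The letters of a reduced word for u are prepended one at a time by the lifting property
`WeakLE.simple_mul`. No finiteness of W_I is assumed, so this is also what makes descent sets
spherical. -/
theorem weakLE_of_mem_parabolic {I : Set B} {u w : W} (hw : I ⊆ cs.leftDescents w)
    (hu : u ∈ cs.parabolic I) : cs.WeakLE u w := by
  obtain ⟨ω, hω, hI, rfl⟩ := exists_isReduced_of_mem_parabolic hu
  clear hu
  induction ω with
  | nil => simpa using one_weakLE w
  | cons i ω ih =>
    have hω' : cs.IsReduced ω := by simpa using hω.drop 1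
    rw [wordProd_cons]
    refine (ih hω' fun k hk ↦ hI k (by simp [hk])).simple_mul (hw (hI i (by simp))) ?_
    rw [cs.not_isLeftDescent_iff, ← wordProd_cons, hω.eq, hω'.eq, List.length_cons]

theorem isSpherical_of_subset_leftDescents {I : Set B} {w : W} (hw : I ⊆ cs.leftDescents w) :
    cs.IsSpherical I :=
  (finite_weakLE w).subset fun _ hu ↦ weakLE_of_mem_parabolic hw hu

theorem subset_leftDescents_longest {I : Set B} (hI : cs.IsSpherical I) :
    I ⊆ cs.leftDescents (cs.longest hI) := by
  intro i hi
  have h := (cs.longest_spec hI).2 _ (mul_mem (simple_mem_parabolic hi) (cs.longest_spec hI).1)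
  exact lt_of_le_of_ne h (cs.length_simple_mul_ne _ _)

theorem weakLE_longest {I : Set B} (hI : cs.IsSpherical I) {u : W} (hu : u ∈ cs.parabolic I) :
    cs.WeakLE u (cs.longest hI) :=
  weakLE_of_mem_parabolic (subset_leftDescents_longest hI) hu

theorem longest_weakLE_iff {I : Set B} (hI : cs.IsSpherical I) {w : W} :
    cs.WeakLE (cs.longest hI) w ↔ I ⊆ cs.leftDescents w :=
  ⟨fun h _ hi ↦ simple_weakLE_iff.1
    ((weakLE_longest hI (simple_mem_parabolic hi)).trans h),
    fun h ↦ weakLE_of_mem_parabolic h (cs.longest_spec hI).1⟩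

/-- A face, as a set, determines W_I only; this makes the top of the face independent of the index
set chosen. -/
theorem longest_congr {I J : Set B} (hI : cs.IsSpherical I) (hJ : cs.IsSpherical J)
    (h : cs.parabolic I = cs.parabolic J) : cs.longest hI = cs.longest hJ :=
  (weakLE_longest hJ (h ▸ (cs.longest_spec hI).1)).antisymm
    (weakLE_longest hI (h ▸ (cs.longest_spec hJ).1))

theorem parabolic_le_of_longest_eq {I J : Set B} (hI : cs.IsSpherical I) (hJ : cs.IsSpherical J)
    (h : cs.longest hI = cs.longest hJ) : cs.parabolic I ≤ cs.parabolic J := by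
  rw [parabolic, Subgroup.closure_le]
  rintro _ ⟨i, hi, rfl⟩
  refine inversions_subset_parabolic (cs.longest_spec hJ).1 ((simple_mem_inversions _).2 ?_)
  rw [← h]
  exact subset_leftDescents_longest hI hi

theorem parabolic_eq_of_longest_eq {I J : Set B} (hI : cs.IsSpherical I) (hJ : cs.IsSpherical J)
    (h : cs.longest hI = cs.longest hJ) : cs.parabolic I = cs.parabolic J :=
  (parabolic_le_of_longest_eq hI hJ h).antisymm (parabolic_le_of_longest_eq hJ hI h.symm)

/-! ### Minimal coset representatives -/

/-- An overlap t of N(x) and xN(u)x⁻¹ would give tx = x(x⁻¹tx), an element of xW_I shorter than x.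
-/
theorem length_mul_of_forall_length_le {I : Set B} {x u : W}
    (hx : ∀ v ∈ cs.parabolic I, cs.length x ≤ cs.length (x * v)) (hu : u ∈ cs.parabolic I) :
    cs.length (x * u) = cs.length x + cs.length u := by
  refine length_mul_of_disjoint_inversions fun t ht ht' ↦ ?_
  have := hx _ (inversions_subset_parabolic hu ht')
  rw [show x * (x⁻¹ * t * x) = t * x by group] at this
  exact absurd ht.2 (by omega)

theorem exists_forall_length_le (I : Set B) (x : W) :
    ∃ u ∈ cs.parabolic I, ∀ v ∈ cs.parabolic I, cs.length (x * u) ≤ cs.length (x * u * v) := by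
  obtain ⟨u, hu, h⟩ := WellFounded.has_min (InvImage.wf (fun u ↦ cs.length (x * u)) wellFounded_lt)
    (cs.parabolic I : Set W) ⟨1, one_mem _⟩
  refine ⟨u, hu, fun v hv ↦ ?_⟩
  rw [mul_assoc]
  exact not_lt.1 (h _ (mul_mem hu hv))

/-- Local minimality implies global minimality: if xa is shortest in the coset and a ≠ 1, a right
descent i ∈ I of a⁻¹ would give ℓ(xs_i) < ℓ(x). -/
theorem length_mul_of_mem_minReps {I : Set B} {x u : W} (hx : x ∈ cs.minReps I)
    (hu : u ∈ cs.parabolic I) : cs.length (x * u) = cs.length x + cs.length u := by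
  obtain ⟨a, ha, hmin⟩ := cs.exists_forall_length_le I x
  rcases eq_or_ne a 1 with rfl | hne
  · exact length_mul_of_forall_length_le (by simpa using hmin) hu
  · obtain ⟨i, hi, hd⟩ := exists_rightDescent_of_mem_parabolic (inv_mem ha) (inv_ne_one.2 hne)
    have h₁ := length_mul_of_forall_length_le hmin (inv_mem ha)
    have h₂ := length_mul_of_forall_length_le hmin
      (mul_mem (inv_mem ha) (simple_mem_parabolic hi))
    have h₃ := hx i hi
    rw [mul_inv_cancel_right] at h₁
    rw [mul_assoc, mul_inv_cancel_left] at h₂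
    unfold IsRightDescent at hd
    omega

theorem mem_minReps_of_forall_length_le {I : Set B} {x : W}
    (hx : ∀ v ∈ cs.parabolic I, cs.length x ≤ cs.length (x * v)) : x ∈ cs.minReps I :=
  fun i hi ↦ lt_of_le_of_ne (hx _ (simple_mem_parabolic hi)) (cs.length_mul_simple_ne x i).symm

theorem exists_minReps (I : Set B) (x : W) :
    ∃ u ∈ cs.parabolic I, x * u ∈ cs.minReps I := by
  obtain ⟨u, hu, h⟩ := cs.exists_forall_length_le I x
  exact ⟨u, hu, mem_minReps_of_forall_length_le h⟩

theorem weakLE_mul_longest {I : Set B} (hI : cs.IsSpherical I) {x : W} (hx : x ∈ cs.minReps I) :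
    cs.WeakLE x (x * cs.longest hI) :=
  weakLE_mul_iff.2 (length_mul_of_mem_minReps hx (cs.longest_spec hI).1)

/-! ### Meets in the weak order -/

/-- Induction on ℓ(x) shows that there is only one maximal common lower bound. Two that share a left
descent agree after cancelling it. -/
theorem exists_isWeakMeet (x y : W) : ∃ z, cs.IsWeakMeet x y z := by
  induction hn : cs.length x using Nat.strong_induction_on generalizing x y with
  | _ n ih =>
  subst hn
  let IsMax (u : W) : Prop := (cs.WeakLE u x ∧ cs.WeakLE u y) ∧
    ∀ v, cs.WeakLE v x → cs.WeakLE v y → cs.WeakLE u v → u = v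
  have hmax : ∀ u, cs.WeakLE u x → cs.WeakLE u y → ∃ v, cs.WeakLE u v ∧ IsMax v := by
    intro u hx hy
    obtain ⟨v, ⟨h₁, h₂, h₃⟩, hv⟩ := Set.exists_max_image
      {v | cs.WeakLE v x ∧ cs.WeakLE v y ∧ cs.WeakLE u v} cs.length
      ((finite_weakLE x).subset fun v hv ↦ hv.1) ⟨u, hx, hy, .refl u⟩
    refine ⟨v, h₃, ⟨h₁, h₂⟩, fun w hw₁ hw₂ hw₃ ↦ ?_⟩
    exact hw₃.eq_of_length_le (hv w ⟨hw₁, hw₂, h₃.trans hw₃⟩)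
  -- two maximal common lower bounds with a common left descent agree
  have hshare : ∀ i u v, cs.IsLeftDescent u i → cs.IsLeftDescent v i → IsMax u → IsMax v →
      u = v := by
    intro i u v hu hv hmu hmv
    have key : ∀ w, cs.IsLeftDescent w i →
        cs.WeakLE (cs.simple i) (cs.simple i * (cs.simple i * w)) := fun w hw ↦ by
      simpa [simple_weakLE_iff] using hw
    have hdx := simple_weakLE_iff.1 ((simple_weakLE_iff.2 hu).trans hmu.1.1)
    have hdy := simple_weakLE_iff.1 ((simple_weakLE_iff.2 hu).trans hmu.1.2)
    obtain ⟨m, hm₁, hm₂, hm₃⟩ := ih _ hdx (cs.simple i * x) (cs.simple i * y) rfl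
    have hcancel : ∀ a b, cs.IsLeftDescent a i → cs.IsLeftDescent b i → cs.WeakLE a b →
        cs.WeakLE (cs.simple i * a) (cs.simple i * b) := fun a b ha hb hab ↦ by
      rw [← WeakLE.mul_left_iff (key a ha) (key b hb)]
      simpa using hab
    have hx' := hm₁.mul_left (key x hdx)
    have hy' := hm₂.mul_left (key y hdy)
    rw [simple_mul_simple_cancel_left] at hx' hy'
    have hm : ∀ w, cs.IsLeftDescent w i → IsMax w → w = cs.simple i * m := by
      intro w hw hmw
      refine hmw.2 _ hx'.2 hy'.2 ?_
      have := ((hm₃ _ (hcancel w x hw hdx hmw.1.1) (hcancel w y hw hdy hmw.1.2)).mul_left hx'.1).2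
      simpa using this
    rw [hm u hu hmu, hm v hv hmv]
  have huniq : ∀ u v, IsMax u → IsMax v → u = v := by
    intro u v hu hv
    rcases eq_or_ne u 1 with rfl | hu₁
    · exact hu.2 v hv.1.1 hv.1.2 (one_weakLE v)
    rcases eq_or_ne v 1 with rfl | hv₁
    · exact (hv.2 u hu.1.1 hu.1.2 (one_weakLE u)).symm
    obtain ⟨i, hi⟩ := cs.exists_leftDescent_of_ne_one hu₁
    obtain ⟨j, hj⟩ := cs.exists_leftDescent_of_ne_one hv₁
    have hi' := simple_weakLE_iff.2 hi
    have hj' := simple_weakLE_iff.2 hj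
    have hx : {i, j} ⊆ cs.leftDescents x := by
      rintro k (rfl | rfl)
      exacts [simple_weakLE_iff.1 (hi'.trans hu.1.1), simple_weakLE_iff.1 (hj'.trans hv.1.1)]
    have hy : {i, j} ⊆ cs.leftDescents y := by
      rintro k (rfl | rfl)
      exacts [simple_weakLE_iff.1 (hi'.trans hu.1.2), simple_weakLE_iff.1 (hj'.trans hv.1.2)]
    -- The longest element of W_{i,j} is a common lower bound; a maximal one above it shares a
    -- descent with both u and v.
    have hIJ := isSpherical_of_subset_leftDescents hx
    obtain ⟨w, hw, hmw⟩ := hmax _ ((longest_weakLE_iff hIJ).2 hx) ((longest_weakLE_iff hIJ).2 hy)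
    have hw := (longest_weakLE_iff hIJ).1 hw
    rw [hshare i u w hi (hw (by simp)) hu hmw, hshare j v w hj (hw (by simp)) hv hmw]
  obtain ⟨z, -, hz⟩ := hmax 1 (one_weakLE x) (one_weakLE y)
  refine ⟨z, hz.1.1, hz.1.2, fun u hx hy ↦ ?_⟩
  obtain ⟨v, huv, hv⟩ := hmax u hx hy
  rwa [huniq z v hz hv]

/-! ### The facial weak order -/

/-- If t is not in N(x), then r = x⁻¹tx lies in W_I and ℓ(tx) = ℓ(x) + ℓ(r). But tx = as_i(a⁻¹x) has
length at most ℓ(x) + 1, so r is simple and x' = xr works. -/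
theorem exists_inversions_subset_insert {I : Set B} {a x w : W} {i : B} (hx : x ∈ cs.minReps I)
    (hw : w ∈ cs.parabolic I) (ha : cs.WeakLE a x)
    (ht : a * cs.simple i * a⁻¹ ∈ cs.inversions (x * w)) :
    ∃ x', cs.WeakLE x x' ∧ a * cs.simple i * a⁻¹ ∈ cs.inversions x' ∧
      cs.inversions x' ⊆ insert (a * cs.simple i * a⁻¹) (cs.inversions x) := by
  set t := a * cs.simple i * a⁻¹ with ht_def
  by_cases htx : t ∈ cs.inversions x
  · exact ⟨x, .refl x, htx, Set.subset_insert _ _⟩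
  have hr : x⁻¹ * t * x ∈ cs.inversions w := by
    rcases cs.mem_inversions_mul.1 ht with ⟨h, _⟩ | ⟨h, _⟩
    exacts [absurd h htx, h]
  have h₁ := length_mul_of_mem_minReps hx (inversions_subset_parabolic hw hr)
  have h₂ : x * (x⁻¹ * t * x) = a * (cs.simple i * (a⁻¹ * x)) := by rw [ht_def]; group
  have h₃ := cs.length_mul_le a (cs.simple i * (a⁻¹ * x))
  have h₄ := cs.length_mul_le (cs.simple i) (a⁻¹ * x)
  rw [length_simple] at h₄
  unfold WeakLE at ha
  have h₅ := hr.1.odd_length.pos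
  rw [h₂] at h₁
  obtain ⟨j, hj⟩ := cs.length_eq_one_iff.1 (show cs.length (x⁻¹ * t * x) = 1 by omega)
  have htj : t = x * cs.simple j * x⁻¹ := by rw [← hj]; group
  have hle : cs.WeakLE x (x * cs.simple j) := by
    rw [weakLE_mul_iff, ← hj, h₂, h₁]
  have hinv := inversions_mul_simple hle
  rw [← htj] at hinv
  exact ⟨_, hle, hinv ▸ Set.mem_insert _ _, hinv.subset⟩

/-- An inversion shared by two faces, sitting atop a common prefix `a` of their bottoms, is either
an inversion of the meet `z` of the bottoms or comes from a simple reflection above `z`. -/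
theorem mem_inversions_or_eq_conj_simple {a x y z t : W} {x' y' : W} {i : B}
    (ht : t = a * cs.simple i * a⁻¹) (haz : cs.WeakLE a (a * cs.simple i))
    (hax : cs.WeakLE a x) (hay : cs.WeakLE a y) (hz : cs.IsWeakMeet x y z)
    (hx : cs.WeakLE x x') (hy : cs.WeakLE y y') (htx : t ∈ cs.inversions x')
    (hty : t ∈ cs.inversions y') (hx' : cs.inversions x' ⊆ insert t (cs.inversions x))
    (hy' : cs.inversions y' ⊆ insert t (cs.inversions y)) :
    t ∈ cs.inversions z ∨ ∃ j, t = z * cs.simple j * z⁻¹ := by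
  obtain ⟨m, hm₁, hm₂, hm₃⟩ := exists_isWeakMeet (cs := cs) x' y'
  have hai := inversions_mul_simple haz
  rw [← ht] at hai
  have ham : cs.WeakLE (a * cs.simple i) m := by
    refine hm₃ _ ?_ ?_ <;> rw [weakLE_iff, hai, Set.insert_subset_iff, ← weakLE_iff]
    exacts [⟨htx, hax.trans hx⟩, ⟨hty, hay.trans hy⟩]
  have htm : t ∈ cs.inversions m := weakLE_iff.1 ham (hai ▸ Set.mem_insert _ _)
  have hzm : cs.WeakLE z m := hm₃ z (hz.1.trans hx) (hz.2.1.trans hy)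
  rcases eq_or_ne z m with rfl | hne
  · exact Or.inl htm
  obtain ⟨j, -, hj₁, hj₂⟩ := exists_mul_simple_weakLE hzm hne
  refine Or.inr ⟨j, ?_⟩
  by_contra hne
  have hzj := inversions_mul_simple hj₁
  have hmem : z * cs.simple j * z⁻¹ ∈ cs.inversions (z * cs.simple j) := hzj ▸ Set.mem_insert _ _
  -- Only t can be new in N(x') and N(y'), so any other inversion added to N(z) already lies in N(x)
  -- and N(y), contradicting that z is their meet.
  have hle : cs.WeakLE (z * cs.simple j) z := by
    refine hz.2.2 _ ?_ ?_ <;> rw [weakLE_iff, hzj, Set.insert_subset_iff, ← weakLE_iff]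
    · exact ⟨(hx' (weakLE_iff.1 (hj₂.trans hm₁) hmem)).resolve_left (Ne.symm hne), hz.1⟩
    · exact ⟨(hy' (weakLE_iff.1 (hj₂.trans hm₂) hmem)).resolve_left (Ne.symm hne), hz.2.1⟩
  exact (weakLE_mul_simple_iff.1 hj₁).not_ge hle.length_le

theorem isSpherical_leftDescents (w : W) : cs.IsSpherical (cs.leftDescents w) :=
  isSpherical_of_subset_leftDescents subset_rfl

theorem mem_minReps_leftDescents {z v : W} (h : cs.WeakLE z v) :
    z ∈ cs.minReps (cs.leftDescents (z⁻¹ * v)) := fun i hi ↦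
  weakLE_mul_simple_iff.1
    ((simple_weakLE_iff (cs := cs).2 hi).mul_left (a := z) (by simpa using h)).1

theorem mul_longest_leftDescents_weakLE {z v : W} (h : cs.WeakLE z v) :
    cs.WeakLE (z * cs.longest (isSpherical_leftDescents (cs := cs) (z⁻¹ * v))) v := by
  simpa using (((longest_weakLE_iff (isSpherical_leftDescents (z⁻¹ * v))).2 subset_rfl).mul_left
    (a := z) (by simpa using h)).2

/-- The join of all simple reflections above `z` inside a meet of faces dominates the top of every
face lying below both of them. -/
theorem mul_longest_weakLE_mul_longest {a x y z v : W} {I J L : Set B} (hI : cs.IsSpherical I)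
    (hJ : cs.IsSpherical J) (hL : cs.IsSpherical L) (hx : x ∈ cs.minReps I)
    (hy : y ∈ cs.minReps J) (ha : a ∈ cs.minReps L) (hz : cs.IsWeakMeet x y z)
    (hv : cs.IsWeakMeet (x * cs.longest hI) (y * cs.longest hJ) v)
    (hax : cs.WeakLE a x) (hay : cs.WeakLE a y)
    (hLx : cs.WeakLE (a * cs.longest hL) (x * cs.longest hI))
    (hLy : cs.WeakLE (a * cs.longest hL) (y * cs.longest hJ)) (hzv : cs.WeakLE z v) :
    cs.WeakLE (a * cs.longest hL)
      (z * cs.longest (isSpherical_leftDescents (cs := cs) (z⁻¹ * v))) := by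
  set hK := isSpherical_leftDescents (cs := cs) (z⁻¹ * v)
  have hzK := weakLE_mul_longest hK (mem_minReps_leftDescents hzv)
  have haz := hz.2.2 a hax hay
  obtain ⟨q, hq⟩ : ∃ q, z * cs.longest hK = a * q := ⟨a⁻¹ * (z * cs.longest hK), by group⟩
  have haq : cs.WeakLE a (a * q) := hq ▸ haz.trans hzK
  rw [hq]
  -- After cancelling the prefix a, it suffices that every i ∈ L is a left descent of q.
  refine (WeakLE.mul_left ((longest_weakLE_iff hL).2 fun i hi ↦ ?_) haq).2
  have hai := weakLE_mul_simple_iff.2 (ha i hi)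
  obtain ⟨t, ht⟩ : ∃ t, t = a * cs.simple i * a⁻¹ := ⟨_, rfl⟩
  have hait : t ∈ cs.inversions (a * cs.simple i) := by
    rw [inversions_mul_simple hai, ht]; exact Set.mem_insert _ _
  have hiL : cs.WeakLE (a * cs.simple i) (a * cs.longest hL) :=
    ((weakLE_longest hL (simple_mem_parabolic hi)).mul_left (weakLE_mul_longest hL ha)).2
  have htv := weakLE_iff.1 (hiL.trans (hv.2.2 _ hLx hLy)) hait
  have htq : t ∈ cs.inversions (z * cs.longest hK) := by
    obtain ⟨x', hx₁, hx₂, hx₃⟩ := exists_inversions_subset_insert hx (cs.longest_spec hI).1 hax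
      (ht ▸ weakLE_iff.1 (hiL.trans hLx) hait)
    obtain ⟨y', hy₁, hy₂, hy₃⟩ := exists_inversions_subset_insert hy (cs.longest_spec hJ).1 hay
      (ht ▸ weakLE_iff.1 (hiL.trans hLy) hait)
    rw [← ht] at hx₂ hx₃ hy₂ hy₃
    by_cases htz : t ∈ cs.inversions z
    · exact weakLE_iff.1 hzK htz
    obtain ⟨j, hj⟩ := (mem_inversions_or_eq_conj_simple ht hai hax hay hz hx₁ hy₁ hx₂ hy₂ hx₃
      hy₃).resolve_left htz
    have hconj : z⁻¹ * t * z = cs.simple j := by rw [hj]; group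
    have hjK : j ∈ cs.leftDescents (z⁻¹ * v) := by
      rw [show v = z * (z⁻¹ * v) by group, mem_inversions_mul, hconj] at htv
      exact (simple_mem_inversions _).1 (htv.resolve_left fun h ↦ htz h.1).1
    rw [mem_inversions_mul, hconj]
    exact Or.inr ⟨(simple_mem_inversions _).2 (subset_leftDescents_longest hK hjK), htz⟩
  rw [hq, mem_inversions_mul, show a⁻¹ * t * a = cs.simple i by rw [ht]; group] at htq
  -- t is not an inversion of a, since ta = as_i is longer than a.
  refine (simple_mem_inversions _).1 (htq.resolve_left fun h ↦ ?_).1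
  have := hai.length_le
  have h₁ := h.1.2
  rw [ht, inv_mul_cancel_right] at h₁
  omega

/-! ### Faces as cosets, the partial order and its meets -/

theorem coset_injective {x y : W} {I J : Set B} {hI : cs.IsSpherical I} {hJ : cs.IsSpherical J}
    (hx : x ∈ cs.minReps I) (hy : y ∈ cs.minReps J) (h : cs.coset x hI = cs.coset y hJ) :
    x = y ∧ cs.parabolic I = cs.parabolic J := by
  have h : x • (cs.parabolic I : Set W) = y • (cs.parabolic J : Set W) :=
    congrArg DavisComplex.carrier h
  have hxy : y⁻¹ * x ∈ cs.parabolic J := by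
    have : x ∈ y • (cs.parabolic J : Set W) := h ▸ mem_own_leftCoset (cs.parabolic I).toSubmonoid x
    simpa [Set.mem_smul_set_iff_inv_smul_mem] using this
  have hyx : x⁻¹ * y ∈ cs.parabolic I := by
    have : y ∈ x • (cs.parabolic I : Set W) := h ▸ mem_own_leftCoset (cs.parabolic J).toSubmonoid y
    simpa [Set.mem_smul_set_iff_inv_smul_mem] using this
  have h₁ := length_mul_of_mem_minReps hy hxy
  have h₂ := length_mul_of_mem_minReps hx hyx
  rw [mul_inv_cancel_left] at h₁ h₂
  have h₃ : cs.length (x⁻¹ * y) = 0 := by omega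
  rw [length_eq_zero_iff, inv_mul_eq_one] at h₃
  subst h₃
  exact ⟨rfl, SetLike.coe_injective (smul_left_cancel x h)⟩

theorem coset_eq_coset {x : W} {I J : Set B} {hI : cs.IsSpherical I} {hJ : cs.IsSpherical J}
    (h : cs.parabolic I = cs.parabolic J) : cs.coset x hI = cs.coset x hJ := by
  ext1
  simp [coset, h]

theorem exists_eq_coset (C : cs.DavisComplex) : ∃ (x : W) (I : Set B) (hI : cs.IsSpherical I),
    x ∈ cs.minReps I ∧ C = cs.coset x hI := by
  obtain ⟨x, I, hI, h⟩ := C.isCoset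
  obtain ⟨u, hu, hx⟩ := exists_minReps (cs := cs) I x
  refine ⟨x * u, I, hI, hx, ?_⟩
  ext1
  rw [h]
  change _ = (x * u) • (cs.parabolic I : Set W)
  rw [mul_smul]
  congr 1
  exact (leftCoset_mem_leftCoset _ hu).symm

theorem facialLE_coset_iff {x y : W} {I J : Set B} {hI : cs.IsSpherical I}
    {hJ : cs.IsSpherical J} (hx : x ∈ cs.minReps I) (hy : y ∈ cs.minReps J) :
    cs.FacialLE (cs.coset x hI) (cs.coset y hJ) ↔
      cs.WeakLE x y ∧ cs.WeakLE (x * cs.longest hI) (y * cs.longest hJ) := by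
  constructor
  · rintro ⟨x', y', I', J', hI', hJ', hx', hy', hC, hD, h₁, h₂⟩
    obtain ⟨rfl, hII⟩ := coset_injective hx hx' hC
    obtain ⟨rfl, hJJ⟩ := coset_injective hy hy' hD
    rw [longest_congr hI hI' hII, longest_congr hJ hJ' hJJ]
    exact ⟨h₁, h₂⟩
  · exact fun h ↦ ⟨x, y, I, J, hI, hJ, hx, hy, rfl, rfl, h⟩

variable (cs) in
/-- The facial weak order as a partial order on the Davis complex. -/
abbrev facialPartialOrder : PartialOrder cs.DavisComplex where
  le := cs.FacialLE
  le_refl C := by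
    obtain ⟨x, I, hI, hx, rfl⟩ := exists_eq_coset C
    exact (facialLE_coset_iff hx hx).2 ⟨.refl _, .refl _⟩
  le_trans C D E h₁ h₂ := by
    obtain ⟨x, I, hI, hx, rfl⟩ := exists_eq_coset C
    obtain ⟨y, J, hJ, hy, rfl⟩ := exists_eq_coset D
    obtain ⟨z, K, hK, hz, rfl⟩ := exists_eq_coset E
    rw [facialLE_coset_iff ‹_› ‹_›] at *
    exact ⟨h₁.1.trans h₂.1, h₁.2.trans h₂.2⟩
  le_antisymm C D h₁ h₂ := by
    obtain ⟨x, I, hI, hx, rfl⟩ := exists_eq_coset C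
    obtain ⟨y, J, hJ, hy, rfl⟩ := exists_eq_coset D
    rw [facialLE_coset_iff ‹_› ‹_›] at *
    obtain rfl := h₁.1.antisymm h₂.1
    exact coset_eq_coset (parabolic_eq_of_longest_eq hI hJ
      (mul_left_cancel (h₁.2.antisymm h₂.2)))

/-- Any weak order meets `z` of the bottoms and `v` of the tops of two faces span a face, which is
the greatest lower bound of the two faces. -/
theorem isGLB_coset {x y z v : W} {I J : Set B} (hI : cs.IsSpherical I)
    (hJ : cs.IsSpherical J) (hx : x ∈ cs.minReps I) (hy : y ∈ cs.minReps J)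
    (hz : cs.IsWeakMeet x y z)
    (hv : cs.IsWeakMeet (x * cs.longest hI) (y * cs.longest hJ) v) :
    z ∈ cs.minReps (cs.leftDescents (z⁻¹ * v)) ∧
      (let D := cs.coset z (isSpherical_leftDescents (cs := cs) (z⁻¹ * v))
      cs.FacialLE D (cs.coset x hI) ∧ cs.FacialLE D (cs.coset y hJ) ∧
        ∀ C, cs.FacialLE C (cs.coset x hI) → cs.FacialLE C (cs.coset y hJ) → cs.FacialLE C D) := by
  have hzv : cs.WeakLE z v := hv.2.2 z (hz.1.trans (weakLE_mul_longest hI hx))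
    (hz.2.1.trans (weakLE_mul_longest hJ hy))
  have hzK := mem_minReps_leftDescents hzv
  have hKv := mul_longest_leftDescents_weakLE hzv
  refine ⟨hzK, ?_, ?_, fun C hCx hCy ↦ ?_⟩
  · exact (facialLE_coset_iff hzK hx).2 ⟨hz.1, hKv.trans hv.1⟩
  · exact (facialLE_coset_iff hzK hy).2 ⟨hz.2.1, hKv.trans hv.2.1⟩
  · obtain ⟨a, L, hL, ha, rfl⟩ := exists_eq_coset C
    rw [facialLE_coset_iff ‹_› ‹_›] at *
    exact ⟨hz.2.2 a hCx.1 hCy.1, mul_longest_weakLE_mul_longest hI hJ hL hx hy ha hz hv hCx.1 hCy.1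
      hCx.2 hCy.2 hzv⟩

theorem exists_facial_inf (C D : cs.DavisComplex) : ∃ E, cs.FacialLE E C ∧ cs.FacialLE E D ∧
    ∀ F, cs.FacialLE F C → cs.FacialLE F D → cs.FacialLE F E := by
  obtain ⟨x, I, hI, hx, rfl⟩ := exists_eq_coset C
  obtain ⟨y, J, hJ, hy, rfl⟩ := exists_eq_coset D
  obtain ⟨z, hz⟩ := exists_isWeakMeet (cs := cs) x y
  obtain ⟨v, hv⟩ := exists_isWeakMeet (cs := cs) (x * cs.longest hI) (y * cs.longest hJ)
  exact ⟨_, (isGLB_coset hI hJ hx hy hz hv).2⟩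

variable (cs) in
/-- The facial weak order as a meet-semilattice on the Davis complex. -/
noncomputable abbrev facialSemilatticeInf : SemilatticeInf cs.DavisComplex where
  __ := cs.facialPartialOrder
  inf C D := (exists_facial_inf C D).choose
  inf_le_left C D := (exists_facial_inf C D).choose_spec.1
  inf_le_right C D := (exists_facial_inf C D).choose_spec.2.1
  le_inf C D E h₁ h₂ := (exists_facial_inf D E).choose_spec.2.2 C h₁ h₂

end CoxeterSystem

theorem theorem3p14 {B : Type*} {M : CoxeterMatrix B} {W : Type*} [Group W]
    (cs : CoxeterSystem M W) :
    ∃ L : SemilatticeInf cs.DavisComplex,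
      (∀ C D : cs.DavisComplex, L.le C D ↔ cs.FacialLE C D) ∧
      ∀ (x y : W) (I J : Set B) (hI : cs.IsSpherical I) (hJ : cs.IsSpherical J),
        x ∈ cs.minReps I → y ∈ cs.minReps J →
        ∃ z v : W, cs.IsWeakMeet x y z ∧
          cs.IsWeakMeet (x * cs.longest hI) (y * cs.longest hJ) v ∧
          z ∈ cs.minReps (cs.leftDescents (z⁻¹ * v)) ∧
          ∃ hK : cs.IsSpherical (cs.leftDescents (z⁻¹ * v)),
            L.inf (cs.coset x hI) (cs.coset y hJ) = cs.coset z hK := by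
  refine ⟨cs.facialSemilatticeInf, fun _ _ ↦ Iff.rfl, fun x y I J hI hJ hx hy ↦ ?_⟩
  obtain ⟨z, hz⟩ := CoxeterSystem.exists_isWeakMeet (cs := cs) x y
  obtain ⟨v, hv⟩ := CoxeterSystem.exists_isWeakMeet (cs := cs) (x * cs.longest hI) (y * cs.longest hJ)
  obtain ⟨hzK, h₁, h₂, h₃⟩ := CoxeterSystem.isGLB_coset hI hJ hx hy hz hv
  refine ⟨z, v, hz, hv, hzK, CoxeterSystem.isSpherical_leftDescents _, ?_⟩
  let := cs.facialSemilatticeInf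
  exact le_antisymm (h₃ _ (inf_le_left (a := cs.coset x hI)) (inf_le_right (b := cs.coset y hJ)))
    (le_inf h₁ h₂)
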